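/- Let $d\ge 2$ be an integer. Let $\mathcal S_d=\{\rho\in\mathbb C^{d\times d}:\rho\ge 0,\ \operatorname{Tr}\rho=1\}$ be the set of quantum states, and let $\mathcal A=\mathcal S_d^*=\{\rho\in\mathcal S_d:\rho^2=\rho\}$ be the set of all rank-1 projectors on $\mathbb C^d$, with its Borel $\sigma$-algebra. Consider the bandit with action set $\mathcal A$ and set of environments $\mathcal S_d$: in each round $t=1,2,\dots$ the learner plays an arm $a_t\in\mathcal A$ and receives the outcome $x_t\in\{0,1\}$ of measuring $a_t$ on a fresh copy of an unknown state $\rho\in\mathcal S_d$, so that, given $a_t$ and the past, $x_t=1$ with probability $\operatorname{Tr}(\rho a_t)$ and $x_t=0$ with probability $1-\operatorname{Tr}(\rho a_t)$. A policy $\pi=(\pi_t)_{t\ge1}$ consists of probability kernels $\pi_t(\cdot\mid a_1,x_1,\dots,a_{t-1},x_{t-1})$ on $\mathcal A$, from which $a_t$ is drawn given the past. With the sub-optimality gap $\Delta_a=\sup_{b\in\mathcal A}\operatorname{Tr}(\rho b)-\operatorname{Tr}(\rho a)$ and with $\mathbb E_{\rho,\pi}$ the expectation under the joint law of $(a_1,x_1,\dots,a_n,x_n)$,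 the expected cumulative regret after $n$ rounds is $$R_n(\mathcal A,\rho,\pi)=\sum_{t=1}^n\mathbb E_{\rho,\pi}\big[\Delta_{a_t}\big].$$ Then there is a constant $C>0$, depending only on $d$, such that for every $n\in\mathbb N$ and every policy $\pi$ there exists an environment $\rho\in\mathcal S_d$ with $$R_n(\mathcal A,\rho,\pi)\ge C\sqrt n .$$ -/

import Mathlib

open MeasureTheory ProbabilityTheory
open scoped ComplexOrder

noncomputable section

namespace QuantumBandit

/-- The set `S_d` of quantum states on `ℂ^d`: positive semidefinite matrices of unit trace. -/
def states (d : ℕ) : Set (Matrix (Fin d) (Fin d) ℂ) :=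
  {ρ | ρ.PosSemidef ∧ ρ.trace = 1}

/-- The set `S_d^*` of pure states, that is, of all rank-1 (orthogonal) projectors on `ℂ^d`:
the idempotent states. -/
def pureStates (d : ℕ) : Set (Matrix (Fin d) (Fin d) ℂ) :=
  {ρ | ρ ∈ states d ∧ ρ * ρ = ρ}

/-- The arms of the bandit: its action set consists of all rank-1 projectors. -/
abbrev Arm (d : ℕ) : Type := ↥(pureStates d)

/-- The action set carries its Borel `σ`-algebra (for the usual topology of complex matrices). -/
instance (d : ℕ) : MeasurableSpace (Arm d) := borel (Arm d)

instance (d : ℕ) : BorelSpace (Arm d) := ⟨rfl⟩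

/-- One round: the arm that is played and the reward that is received. The reward is the outcome
of measuring a projector, hence one of its eigenvalues `0`, `1`, encoded in `Fin 2`. -/
abbrev Round (d : ℕ) : Type := Arm d × Fin 2

/-- The spectral projector of the observable `a` for the eigenvalue `x ∈ {0, 1}`:
`a` itself for `x = 1` and `1 - a` for `x = 0`, so that `a = 1 • a + 0 • (1 - a)`. -/
def spectralProj {d : ℕ} (a : Arm d) (x : Fin 2) : Matrix (Fin d) (Fin d) ℂ :=
  if x = 1 then (a : Matrix (Fin d) (Fin d) ℂ) else 1 - (a : Matrix (Fin d) (Fin d) ℂ)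

/-- Born's rule: the probability `P_ρ(x | a) = Tr (ρ Π_{a,x})` of the reward `x` when the arm `a`
is played on the environment state `ρ`. -/
def bornProb {d : ℕ} (ρ : states d) (a : Arm d) (x : Fin 2) : ℝ :=
  (Matrix.trace ((ρ : Matrix (Fin d) (Fin d) ℂ) * spectralProj a x)).re

lemma continuous_bornProb {d : ℕ} (ρ : states d) (x : Fin 2) :
    Continuous fun a : Arm d => bornProb ρ a x := by
  unfold bornProb spectralProj
  split_ifs
  · exact Complex.continuous_re.comp
      ((continuous_const.matrix_mul continuous_subtype_val).matrix_trace)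
  · exact Complex.continuous_re.comp
      ((continuous_const.matrix_mul (continuous_const.sub continuous_subtype_val)).matrix_trace)

/-- A spectral projector is a Hermitian idempotent. -/
lemma spectralProj_herm_idem {d : ℕ} (a : Arm d) (x : Fin 2) :
    (spectralProj a x).conjTranspose = spectralProj a x ∧
      spectralProj a x * spectralProj a x = spectralProj a x := by
  have h1 : (a : Matrix (Fin d) (Fin d) ℂ).conjTranspose = a := a.2.1.1.1
  have h2 : (a : Matrix (Fin d) (Fin d) ℂ) * a = a := a.2.2
  unfold spectralProj
  split_ifs
  · exact ⟨h1, h2⟩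
  · refine ⟨by simp [h1], ?_⟩
    simp [sub_mul, mul_sub, h2]

lemma bornProb_nonneg {d : ℕ} (ρ : states d) (a : Arm d) (x : Fin 2) : 0 ≤ bornProb ρ a x := by
  obtain ⟨h1, h2⟩ := spectralProj_herm_idem a x
  have h : 0 ≤ Matrix.trace ((spectralProj a x).conjTranspose *
      (ρ : Matrix (Fin d) (Fin d) ℂ) * spectralProj a x) :=
    (ρ.2.1.conjTranspose_mul_mul_same (spectralProj a x)).trace_nonneg
  rw [h1, Matrix.trace_mul_comm, ← mul_assoc, h2, Matrix.trace_mul_comm] at h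
  exact (Complex.le_def.1 h).1

lemma sum_bornProb {d : ℕ} (ρ : states d) (a : Arm d) : ∑ x, bornProb ρ a x = 1 := by
  have h : (ρ : Matrix (Fin d) (Fin d) ℂ).trace = 1 := ρ.2.2
  simp [bornProb, spectralProj, Fin.sum_univ_two, mul_sub, h]

/-- The conditional distribution `P_ρ(· | a)` of the reward, as a kernel from arms to rewards. -/
def rewardKernel {d : ℕ} (ρ : states d) : Kernel (Arm d) (Fin 2) where
  toFun a := ∑ x, ENNReal.ofReal (bornProb ρ a x) • Measure.dirac x
  measurable' := by
    refine Measure.measurable_of_measurable_coe _ fun s _ => ?_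
    simp only [Measure.coe_finsetSum, Finset.sum_apply, Measure.smul_apply, smul_eq_mul]
    exact Finset.measurable_sum _ fun x _ =>
      ((continuous_bornProb ρ x).measurable.ennreal_ofReal).mul_const _

instance {d : ℕ} (ρ : states d) : IsMarkovKernel (rewardKernel ρ) := by
  refine ⟨fun a => ⟨?_⟩⟩
  change (∑ x, ENNReal.ofReal (bornProb ρ a x) • Measure.dirac x : Measure (Fin 2)) Set.univ = 1
  simp only [Measure.coe_finsetSum, Finset.sum_apply, Measure.smul_apply, smul_eq_mul,
    measure_univ, mul_one]
  rw [← ENNReal.ofReal_sum_of_nonneg fun x _ => bornProb_nonneg ρ a x, sum_bornProb,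
    ENNReal.ofReal_one]

/-- A policy: for every `t`, the conditional distribution of the next arm, given the arms and
rewards of the first `t` rounds. -/
structure Policy (d : ℕ) where
  kernel : ∀ t : ℕ, Kernel (Fin t → Round d) (Arm d)
  markov : ∀ t : ℕ, IsMarkovKernel (kernel t)

instance {d : ℕ} (π : Policy d) (t : ℕ) : IsMarkovKernel (π.kernel t) := π.markov t

/-- The law of the next round given the history: an arm is drawn from the policy, then the reward
is drawn by Born's rule for this arm. -/
def roundKernel {d : ℕ} (ρ : states d) (π : Policy d) (t : ℕ) :
    Kernel (Fin t → Round d) (Round d) :=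
  (π.kernel t).compProd (Kernel.prodMkLeft (Fin t → Round d) (rewardKernel ρ))

instance {d : ℕ} (ρ : states d) (π : Policy d) (t : ℕ) : IsMarkovKernel (roundKernel ρ π t) := by
  unfold roundKernel
  infer_instance

/-- Append a round to a history of `n` rounds. -/
def appendRound {d n : ℕ} (p : (Fin n → Round d) × Round d) : Fin (n + 1) → Round d :=
  Fin.snoc (α := fun _ => Round d) p.1 p.2

lemma measurable_appendRound {d n : ℕ} : Measurable (appendRound (d := d) (n := n)) := by
  refine measurable_pi_lambda _ fun i => ?_
  refine Fin.lastCases ?_ (fun j => ?_) i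
  · simpa [appendRound] using measurable_snd
  · simpa [appendRound, Function.comp_def] using
      ((measurable_pi_apply j).comp measurable_fst : Measurable
        ((fun f : Fin n → Round d => f j) ∘ (Prod.fst : (Fin n → Round d) × Round d → _)))

/-- The joint law `P_{ρ,π}` of the arms and rewards of the first `n` rounds, when the policy `π` is
run on the environment state `ρ`. -/
def historyLaw {d : ℕ} (ρ : states d) (π : Policy d) : ∀ n : ℕ, Measure (Fin n → Round d)
  | 0 => Measure.dirac Fin.elim0
  | n + 1 => ((historyLaw ρ π n).compProd (roundKernel ρ π n)).map appendRound

instance {d : ℕ} (ρ : states d) (π : Policy d) (n : ℕ) :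
    IsProbabilityMeasure (historyLaw ρ π n) := by
  induction n with
  | zero => unfold historyLaw; infer_instance
  | succ n ih =>
    unfold historyLaw
    exact Measure.isProbabilityMeasure_map measurable_appendRound.aemeasurable

/-- The expected reward `E_{ρ|a}` of the arm `a`, the mean of `P_ρ(· | a)`. -/
def meanReward {d : ℕ} (ρ : states d) (a : Arm d) : ℝ :=
  ∑ x : Fin 2, ((x : ℕ) : ℝ) * bornProb ρ a x

/-- The sub-optimality gap `Δ_a`, the supremum over the arms `b` of `E_{ρ|b} - E_{ρ|a}`. -/
def gap {d : ℕ} (ρ : states d) (a : Arm d) : ℝ :=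
  ⨆ b : Arm d, (meanReward ρ b - meanReward ρ a)

/-- The expected cumulative regret after `n` rounds: the sum over the rounds `t` of the expectation
of `Δ_{a_t}` under `P_{ρ,π}`. -/
def regret {d : ℕ} (n : ℕ) (ρ : states d) (π : Policy d) : ℝ :=
  ∑ t : Fin n, ∫ h, gap ρ (h t).1 ∂(historyLaw ρ π n)

end QuantumBandit

end

/-! Two nearby mixed states already force the bound. Move weight `s` between two basis vectors of
the maximally mixed state, giving `ρ₊` and `ρ₋`. No arm is good in both: its two gaps add up to at
least `2s` (`gap_add_gap_shiftedState`).

At the maximally mixed state every outcome of every arm has probability at least `1/d`. The product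
of the likelihood ratios of `ρ₊` and `ρ₋` in one round is therefore at least `1 - (ds)²`, and over
`n` rounds at least `1 - n(ds)²`, for every history (`historyRatio_mul_ge`). Being pointwise, this
bound is indifferent to the adaptivity of the policy.

If `n(ds)² ≤ 1/2`, the two history laws overlap enough that each round contributes at least `s/2` to
the sum of the regrets (`two_point_bound`). Taking `s` of order `1/(d√n)` makes this sum of order
`√n/d`. -/

namespace QuantumBandit

open scoped ENNReal

/-! ### Change of environment by likelihood ratios -/

section LikelihoodRatio

variable {d : ℕ}

lemma bornProb_le_one (ρ : states d) (a : Arm d) (x : Fin 2) : bornProb ρ a x ≤ 1 := by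
  rw [← sum_bornProb ρ a]
  exact Finset.single_le_sum (f := bornProb ρ a) (fun y _ => bornProb_nonneg ρ a y)
    (Finset.mem_univ x)

lemma bornProb_zero (ρ : states d) (a : Arm d) : bornProb ρ a 0 = 1 - bornProb ρ a 1 := by
  have h := sum_bornProb ρ a
  rw [Fin.sum_univ_two] at h
  linarith

lemma meanReward_eq (ρ : states d) (a : Arm d) : meanReward ρ a = bornProb ρ a 1 := by
  simp [meanReward, Fin.sum_univ_two]

/-- The ratio of the outcome probabilities in the environments `ρ` and `σ`. -/
noncomputable def likelihoodRatio (ρ σ : states d) (r : Round d) : ℝ :=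
  bornProb ρ r.1 r.2 / bornProb σ r.1 r.2

lemma likelihoodRatio_nonneg (ρ σ : states d) (r : Round d) : 0 ≤ likelihoodRatio ρ σ r :=
  div_nonneg (bornProb_nonneg _ _ _) (bornProb_nonneg _ _ _)

lemma measurable_likelihoodRatio (ρ σ : states d) : Measurable (likelihoodRatio ρ σ) :=
  measurable_from_prod_countable_left fun x =>
    (continuous_bornProb ρ x).measurable.div (continuous_bornProb σ x).measurable

/-- The likelihood ratio of a whole history. -/
noncomputable def historyRatio (ρ σ : states d) (n : ℕ) (h : Fin n → Round d) : ℝ :=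
  ∏ t, likelihoodRatio ρ σ (h t)

lemma historyRatio_nonneg (ρ σ : states d) (n : ℕ) (h : Fin n → Round d) :
    0 ≤ historyRatio ρ σ n h :=
  Finset.prod_nonneg fun _ _ => likelihoodRatio_nonneg _ _ _

lemma measurable_historyRatio (ρ σ : states d) (n : ℕ) : Measurable (historyRatio ρ σ n) :=
  Finset.measurable_prod _ fun t _ =>
    (measurable_likelihoodRatio ρ σ).comp (measurable_pi_apply t)

lemma historyRatio_appendRound (ρ σ : states d) (n : ℕ) (p : (Fin n → Round d) × Round d) :
    historyRatio ρ σ (n + 1) (appendRound p) =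
      historyRatio ρ σ n p.1 * likelihoodRatio ρ σ p.2 := by
  simp [historyRatio, appendRound, Fin.prod_univ_castSucc]

lemma lintegral_rewardKernel (ρ : states d) (a : Arm d) (f : Fin 2 → ℝ≥0∞) :
    ∫⁻ x, f x ∂(rewardKernel ρ a) = ∑ x, ENNReal.ofReal (bornProb ρ a x) * f x := by
  change ∫⁻ x, f x ∂(∑ x, ENNReal.ofReal (bornProb ρ a x) • Measure.dirac x) = _
  simp

/-- The policy draws the arm by the same kernel in both environments, so only the outcome
probabilities enter the density. Positivity under `σ` makes the quotient cancel. -/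
lemma lintegral_roundKernel (ρ σ : states d) (hσ : ∀ a x, 0 < bornProb σ a x) (π : Policy d)
    (n : ℕ) (h : Fin n → Round d) (f : Round d → ℝ≥0∞) (hf : Measurable f) :
    ∫⁻ r, f r ∂(roundKernel ρ π n h) =
      ∫⁻ r, ENNReal.ofReal (likelihoodRatio ρ σ r) * f r ∂(roundKernel σ π n h) := by
  unfold roundKernel
  have hLf : Measurable fun r => ENNReal.ofReal (likelihoodRatio ρ σ r) * f r :=
    (measurable_likelihoodRatio ρ σ).ennreal_ofReal.mul hf
  rw [Kernel.lintegral_compProd _ _ _ hf, Kernel.lintegral_compProd _ _ _ hLf]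
  refine lintegral_congr fun a => ?_
  simp only [Kernel.prodMkLeft_apply, lintegral_rewardKernel]
  refine Finset.sum_congr rfl fun x _ => ?_
  rw [← mul_assoc, ← ENNReal.ofReal_mul (bornProb_nonneg _ _ _), likelihoodRatio,
    mul_div_cancel₀ _ (hσ a x).ne']

lemma lintegral_historyLaw (ρ σ : states d) (hσ : ∀ a x, 0 < bornProb σ a x) (π : Policy d)
    (n : ℕ) (f : (Fin n → Round d) → ℝ≥0∞) (hf : Measurable f) :
    ∫⁻ h, f h ∂(historyLaw ρ π n) =
      ∫⁻ h, ENNReal.ofReal (historyRatio ρ σ n h) * f h ∂(historyLaw σ π n) := by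
  induction n with
  | zero => simp [historyLaw, historyRatio]
  | succ n ih =>
    have hL := (measurable_historyRatio ρ σ (n + 1)).ennreal_ofReal
    have hfa : Measurable fun p : (Fin n → Round d) × Round d => f (appendRound p) :=
      hf.comp measurable_appendRound
    have hLf : Measurable fun h => ENNReal.ofReal (historyRatio ρ σ (n + 1) h) * f h := hL.mul hf
    have hLa : Measurable fun p : (Fin n → Round d) × Round d =>
        ENNReal.ofReal (historyRatio ρ σ (n + 1) (appendRound p)) * f (appendRound p) :=
      hLf.comp measurable_appendRound
    unfold historyLaw
    rw [lintegral_map hf measurable_appendRound, lintegral_map hLf measurable_appendRound,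
      Measure.lintegral_compProd hfa, Measure.lintegral_compProd hLa,
      ih _ hfa.lintegral_kernel_prod_right']
    refine lintegral_congr fun h => ?_
    have hm : Measurable fun r : Round d => f (appendRound (h, r)) :=
      hfa.comp measurable_prodMk_left
    rw [lintegral_roundKernel ρ σ hσ π n h _ hm, ← lintegral_const_mul' _ _ ENNReal.ofReal_ne_top]
    refine lintegral_congr fun r => ?_
    rw [historyRatio_appendRound, ENNReal.ofReal_mul (historyRatio_nonneg _ _ _ _), mul_assoc]

/-- The law of the history in the environment `ρ` has the likelihood ratio as its density with
respect to the law in an environment in which all outcomes have positive probability. -/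
lemma historyLaw_eq_withDensity (ρ σ : states d) (hσ : ∀ a x, 0 < bornProb σ a x) (π : Policy d)
    (n : ℕ) :
    historyLaw ρ π n =
      (historyLaw σ π n).withDensity fun h => ENNReal.ofReal (historyRatio ρ σ n h) := by
  ext s hs
  rw [withDensity_apply _ hs, ← lintegral_indicator_one hs,
    lintegral_historyLaw ρ σ hσ π n _ (measurable_one.indicator hs), ← lintegral_indicator hs]
  refine lintegral_congr fun h => ?_
  by_cases hh : h ∈ s <;> simp [hh]

end LikelihoodRatio

/-! ### Overlap of two laws -/

section TwoPoint

/-- A two-point lower bound: if the product of the densities `L`, `M` of two probability measures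
is at least `1/2`, then their overlap is at least `1/4`. -/
lemma two_point_bound {Ω : Type*} [MeasurableSpace Ω] (μ μ₁ μ₂ : Measure Ω)
    [IsProbabilityMeasure μ] [IsProbabilityMeasure μ₁] [IsProbabilityMeasure μ₂]
    (L M : Ω → ℝ) (hL : Measurable L) (hM : Measurable M) (hL0 : ∀ ω, 0 ≤ L ω)
    (hM0 : ∀ ω, 0 ≤ M ω) (h₁ : μ₁ = μ.withDensity fun ω => ENNReal.ofReal (L ω))
    (h₂ : μ₂ = μ.withDensity fun ω => ENNReal.ofReal (M ω)) (hLM : ∀ ω, 1 / 2 ≤ L ω * M ω)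
    (f g : Ω → ℝ) (hf : Integrable f μ₁) (hg : Integrable g μ₂) (hf0 : ∀ ω, 0 ≤ f ω)
    (hg0 : ∀ ω, 0 ≤ g ω) (c : ℝ) (hc : 0 ≤ c) (hfg : ∀ ω, c ≤ f ω + g ω) :
    c / 4 ≤ ∫ ω, f ω ∂μ₁ + ∫ ω, g ω ∂μ₂ := by
  have key : ∀ (N : Ω → ℝ) (ν : Measure Ω), Measurable N → (∀ ω, 0 ≤ N ω) →
      (ν = μ.withDensity fun ω => ENNReal.ofReal (N ω)) → ∀ k : Ω → ℝ, Integrable k ν →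
      Integrable (fun ω => N ω * k ω) μ ∧ ∫ ω, k ω ∂ν = ∫ ω, N ω * k ω ∂μ := by
    rintro N ν hN hN0 rfl k hk
    constructor
    · rw [integrable_withDensity_iff_integrable_smul' hN.ennreal_ofReal (by simp)] at hk
      simpa [ENNReal.toReal_ofReal (hN0 _)] using hk
    · rw [integral_withDensity_eq_integral_toReal_smul hN.ennreal_ofReal (by simp)]
      simp [ENNReal.toReal_ofReal (hN0 _)]
  obtain ⟨iL, eL⟩ := key L μ₁ hL hL0 h₁ (fun _ => 1) (integrable_const _)
  obtain ⟨iM, eM⟩ := key M μ₂ hM hM0 h₂ (fun _ => 1) (integrable_const _)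
  obtain ⟨iF, eF⟩ := key L μ₁ hL hL0 h₁ f hf
  obtain ⟨iG, eG⟩ := key M μ₂ hM hM0 h₂ g hg
  simp only [mul_one, integral_const, probReal_univ, smul_eq_mul] at iL eL iM eM
  rw [eF, eG, ← integral_add iF iG]
  have iLM : Integrable (fun ω => (L ω + M ω) / 4) μ := (iL.add iM).div_const _
  -- Both densities integrate to `1`, so the integral is `c / 2 * (1 - 2 / 4)`.
  have hint : ∫ ω, c / 2 * (1 - (L ω + M ω) / 4) ∂μ = c / 4 := by
    rw [integral_const_mul, integral_sub (integrable_const _) iLM,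
      integral_div, integral_add iL iM, ← eL, ← eM]
    simp only [integral_const, probReal_univ, smul_eq_mul]
    ring
  rw [← hint]
  refine integral_mono (((integrable_const _).sub iLM).const_mul _)
    (iF.add iG) fun ω => ?_
  -- A linear lower bound for `min L M`. Were it false, multiplying by `y` would give `9xy/8 ≤ 1/2 -
  -- (y - 2)²/8`, hence `xy ≤ 4/9 < 1/2`.
  have hmin : ∀ x y : ℝ, 0 ≤ x → 0 ≤ y → 1 / 2 ≤ x * y → 1 / 2 * (1 - (x + y) / 4) ≤ x := by
    intro x y hx hy hxy
    by_contra! hlt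
    nlinarith [sq_nonneg (y - 2), mul_le_mul_of_nonneg_left hlt.le hy]
  have hl := hmin (L ω) (M ω) (hL0 ω) (hM0 ω) (hLM ω)
  have hm := hmin (M ω) (L ω) (hM0 ω) (hL0 ω) (by linarith [hLM ω])
  have e1 := mul_le_mul_of_nonneg_right hl (hf0 ω)
  have e2 := mul_le_mul_of_nonneg_right hm (hg0 ω)
  dsimp only
  -- When this factor is negative the minorant is nonpositive, and nonnegativity of the integrand
  -- suffices.
  by_cases hs : 0 ≤ 1 - (L ω + M ω) / 4
  · nlinarith [mul_le_mul_of_nonneg_left (hfg ω) hs]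
  · nlinarith [mul_nonneg (hL0 ω) (hf0 ω), mul_nonneg (hM0 ω) (hg0 ω)]

end TwoPoint

/-! ### Bounds and measurability of the gap -/

section Gap

variable {d : ℕ}

lemma bddAbove_gap (ρ : states d) (a : Arm d) :
    BddAbove (Set.range fun b : Arm d => meanReward ρ b - meanReward ρ a) := by
  refine ⟨1, ?_⟩
  rintro _ ⟨b, rfl⟩
  dsimp only
  rw [meanReward_eq, meanReward_eq]
  linarith [bornProb_le_one ρ b 1, bornProb_nonneg ρ a 1]

lemma le_gap (ρ : states d) (a b : Arm d) : meanReward ρ b - meanReward ρ a ≤ gap ρ a :=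
  le_ciSup (bddAbove_gap ρ a) b

lemma gap_nonneg (ρ : states d) (a : Arm d) : 0 ≤ gap ρ a := by
  simpa using le_gap ρ a a

lemma gap_le_one (ρ : states d) (a : Arm d) : gap ρ a ≤ 1 := by
  have : Nonempty (Arm d) := ⟨a⟩
  refine ciSup_le fun b => ?_
  rw [meanReward_eq, meanReward_eq]
  linarith [bornProb_le_one ρ b 1, bornProb_nonneg ρ a 1]

/-- The supremum runs over an uncountable family, but it splits off as a constant independent of
`a`, leaving a continuous function. -/
lemma measurable_gap (ρ : states d) : Measurable (gap ρ) := by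
  have h : ∀ a, gap ρ a = (⨆ b : Arm d, bornProb ρ b 1) - bornProb ρ a 1 := by
    intro a
    have : Nonempty (Arm d) := ⟨a⟩
    simp only [gap, meanReward_eq]
    refine (ciSup_sub ⟨1, ?_⟩ _).symm
    rintro _ ⟨b, rfl⟩
    exact bornProb_le_one ρ b 1
  rw [funext h]
  exact measurable_const.sub (continuous_bornProb ρ 1).measurable

lemma integrable_gap (ρ : states d) (n : ℕ) (t : Fin n) (μ : Measure (Fin n → Round d))
    [IsFiniteMeasure μ] : Integrable (fun h => gap ρ (h t).1) μ := by
  refine Integrable.of_bound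
    ((measurable_gap ρ).comp (measurable_fst.comp (measurable_pi_apply t))).aestronglyMeasurable 1
    (ae_of_all _ fun h => ?_)
  rw [Real.norm_of_nonneg (gap_nonneg _ _)]
  exact gap_le_one _ _

end Gap

/-! ### The two perturbed states -/

section DiagonalStates

variable {d : ℕ}

lemma diagonal_mem_states (r : Fin d → ℝ) (h0 : ∀ i, 0 ≤ r i) (h1 : ∑ i, r i = 1) :
    Matrix.diagonal (fun i => (r i : ℂ)) ∈ states d := by
  refine ⟨Matrix.PosSemidef.diagonal fun i => ?_, ?_⟩
  · exact Complex.zero_le_real.2 (h0 i)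
  · rw [Matrix.trace_diagonal]
    exact_mod_cast h1

/-- The maximally mixed state, with the weight `s` moved from the basis vector `j` to `i`. -/
noncomputable def shiftedState (i j : Fin d) (s : ℝ) (hs : |s| ≤ 1 / d) : states d :=
  ⟨Matrix.diagonal fun k =>
      ((1 / d + s * ((Pi.single i 1 : Fin d → ℝ) k - (Pi.single j 1 : Fin d → ℝ) k) : ℝ) : ℂ), by
    have hd : (d : ℝ) ≠ 0 := by
      have := i.pos
      positivity
    refine diagonal_mem_states _ (fun k => ?_) ?_
    · have h1 := abs_le.1 hs
      by_cases hi : k = i <;> by_cases hj : k = j <;> simp [Pi.single_apply, hi, hj] <;>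
        first | linarith | (split_ifs <;> simp_all <;> linarith)
    · rw [Finset.sum_add_distrib, ← Finset.mul_sum, Finset.sum_sub_distrib]
      simp [hd]⟩

/-- The difference of two diagonal entries of an arm. -/
noncomputable def diagDiff (i j : Fin d) (a : Arm d) : ℝ := (a.1 i i).re - (a.1 j j).re

lemma abs_diagDiff_le (i j : Fin d) (a : Arm d) : |diagDiff i j a| ≤ 1 := by
  have h0 : ∀ k, 0 ≤ (a.1 k k).re := fun k => (Complex.le_def.1 (a.2.1.1.diag_nonneg (i := k))).1
  have h1 : ∑ k, (a.1 k k).re = 1 := by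
    have := congrArg Complex.re a.2.1.2
    simpa [Matrix.trace] using this
  have h2 : ∀ k, (a.1 k k).re ≤ 1 := fun k =>
    h1 ▸ Finset.single_le_sum (f := fun k => (a.1 k k).re) (fun k _ => h0 k) (Finset.mem_univ k)
  rw [diagDiff, abs_le]
  constructor <;> linarith [h0 i, h0 j, h2 i, h2 j]

lemma bornProb_shiftedState_one (i j : Fin d) (s : ℝ) (hs : |s| ≤ 1 / d) (a : Arm d) :
    bornProb (shiftedState i j s hs) a 1 = 1 / d + s * diagDiff i j a := by
  have h1 : ∑ k, (a.1 k k).re = 1 := by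
    have := congrArg Complex.re a.2.1.2
    simpa [Matrix.trace] using this
  simp only [bornProb, spectralProj, shiftedState, if_true, Matrix.trace, Matrix.diag_apply,
    Matrix.diagonal_mul, Complex.re_sum, Complex.re_ofReal_mul]
  simp only [add_mul, mul_assoc, sub_mul, Finset.sum_add_distrib, ← Finset.mul_sum,
    Finset.sum_sub_distrib, h1, Pi.single_apply, diagDiff]
  simp

/-- The projector on a vector of the standard basis. -/
noncomputable def basisArm (i : Fin d) : Arm d :=
  ⟨Matrix.diagonal fun k => (((Pi.single i 1 : Fin d → ℝ) k : ℝ) : ℂ), by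
    refine ⟨diagonal_mem_states _ (fun k => ?_) (by simp), ?_⟩
    · by_cases h : k = i <;> simp [h]
    · rw [Matrix.diagonal_mul_diagonal]
      congr 1
      ext k
      by_cases h : k = i <;> simp [h]⟩

lemma diagDiff_basisArm {i j : Fin d} (hij : i ≠ j) :
    diagDiff i j (basisArm i) = 1 ∧ diagDiff i j (basisArm j) = -1 := by
  simp [diagDiff, basisArm, Pi.single_apply, hij, hij.symm]

/-- Comparison with the basis arms `i` and `j` bounds the gaps below by `s(1 - δ)` and `s(1 + δ)`,
where `δ` is `diagDiff i j a`; `δ` cancels in the sum. -/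
lemma gap_add_gap_shiftedState {i j : Fin d} (hij : i ≠ j) (s : ℝ) (hs : |s| ≤ 1 / d)
    (hs' : |-s| ≤ 1 / d) (a : Arm d) :
    2 * s ≤ gap (shiftedState i j s hs) a + gap (shiftedState i j (-s) hs') a := by
  have h1 := le_gap (shiftedState i j s hs) a (basisArm i)
  have h2 := le_gap (shiftedState i j (-s) hs') a (basisArm j)
  simp only [meanReward_eq, bornProb_shiftedState_one, diagDiff_basisArm hij] at h1 h2
  linarith

/-- Treats both outcomes uniformly. For outcome `0` the bound on `p` is `1 - 1/d ≥ 1/d`, which needs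
`d ≥ 2`. -/
lemma exists_bornProb_shiftedState (hd : 2 ≤ d) (i j : Fin d) (a : Arm d) (x : Fin 2) :
    ∃ p η : ℝ, 1 / d ≤ p ∧ |η| ≤ 1 ∧
      ∀ s hs, bornProb (shiftedState i j s hs) a x = p + s * η := by
  have hd' : (2 : ℝ) ≤ d := by exact_mod_cast hd
  have hh := abs_diagDiff_le i j a
  fin_cases x
  · refine ⟨1 - 1 / d, -diagDiff i j a, ?_, by rwa [abs_neg], fun s hs => ?_⟩
    · have : (1 : ℝ) / d ≤ 1 / 2 := by gcongr
      linarith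
    · change bornProb _ a 0 = _
      rw [bornProb_zero, bornProb_shiftedState_one]
      ring
  · exact ⟨1 / d, diagDiff i j a, le_rfl, hh, fun s hs => bornProb_shiftedState_one i j s hs a⟩

/-- The first-order terms in `s` cancel: `(p + sη)(p - sη) = p² - s²η²`, and `η² ≤ 1 ≤ (dp)²`. -/
lemma likelihoodRatio_mul_ge (hd : 2 ≤ d) (i j : Fin d) (s : ℝ) (hs : |s| ≤ 1 / d)
    (hs' : |-s| ≤ 1 / d) (h0 : |(0 : ℝ)| ≤ 1 / d) (r : Round d) :
    1 - (d * s) ^ 2 ≤ likelihoodRatio (shiftedState i j s hs) (shiftedState i j 0 h0) r *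
      likelihoodRatio (shiftedState i j (-s) hs') (shiftedState i j 0 h0) r := by
  obtain ⟨p, η, hp, hη, hb⟩ := exists_bornProb_shiftedState hd i j r.1 r.2
  have hd' : (0 : ℝ) < d := by positivity
  have hp0 : 0 < p := lt_of_lt_of_le (by positivity) hp
  have hdp : 1 ≤ d * p := by rwa [div_le_iff₀' hd'] at hp
  have hη2 : η ^ 2 ≤ 1 := (sq_le_one_iff_abs_le_one η).2 hη
  simp only [likelihoodRatio, hb, zero_mul, add_zero]
  rw [div_mul_div_comm, le_div_iff₀ (by positivity)]
  have h1 : s ^ 2 * η ^ 2 ≤ s ^ 2 * (d * p) ^ 2 :=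
    mul_le_mul_of_nonneg_left (hη2.trans (one_le_pow₀ hdp)) (sq_nonneg s)
  nlinarith

lemma historyRatio_mul_ge (hd : 2 ≤ d) (i j : Fin d) (s : ℝ) (hs : |s| ≤ 1 / d)
    (hs' : |-s| ≤ 1 / d) (h0 : |(0 : ℝ)| ≤ 1 / d) (n : ℕ) (h : Fin n → Round d) :
    1 - n * (d * s) ^ 2 ≤ historyRatio (shiftedState i j s hs) (shiftedState i j 0 h0) n h *
      historyRatio (shiftedState i j (-s) hs') (shiftedState i j 0 h0) n h := by
  have hds : (d * s) ^ 2 ≤ 1 := by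
    have hd' : (0 : ℝ) < d := by positivity
    rw [sq_le_one_iff_abs_le_one, abs_mul, abs_of_pos hd']
    rwa [le_div_iff₀' hd'] at hs
  -- Bernoulli's inequality turns the product of the one-round bounds into a linear one.
  have hB := one_add_mul_le_pow (a := -(d * s) ^ 2) (by linarith) n
  unfold historyRatio
  rw [← Finset.prod_mul_distrib]
  calc 1 - n * (d * s) ^ 2 ≤ (1 - (d * s) ^ 2) ^ n := by
        simpa [sub_eq_add_neg] using hB
    _ = ∏ _t : Fin n, (1 - (d * s) ^ 2) := by simp
    _ ≤ _ := Finset.prod_le_prod (fun _ _ => by linarith)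
        fun t _ => likelihoodRatio_mul_ge hd i j s hs hs' h0 (h t)

lemma regret_add_regret_ge (hd : 2 ≤ d) {i j : Fin d} (hij : i ≠ j) (s : ℝ) (hs0 : 0 ≤ s)
    (hs : |s| ≤ 1 / d) (hs' : |-s| ≤ 1 / d) (n : ℕ) (hn : n * (d * s) ^ 2 ≤ 1 / 2)
    (π : Policy d) :
    n * (s / 2) ≤ regret n (shiftedState i j s hs) π + regret n (shiftedState i j (-s) hs') π := by
  have h0 : |(0 : ℝ)| ≤ 1 / d := by simp
  have hpos : ∀ a x, 0 < bornProb (shiftedState i j 0 h0) a x := fun a x => by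
    obtain ⟨p, η, hp, -, hb⟩ := exists_bornProb_shiftedState hd i j a x
    rw [hb, zero_mul, add_zero]
    exact lt_of_lt_of_le (by positivity) hp
  unfold regret
  rw [← Finset.sum_add_distrib]
  have hsum : (n : ℝ) * (s / 2) = ∑ _t : Fin n, 2 * s / 4 := by
    simp only [Finset.sum_const, Finset.card_univ, Fintype.card_fin, nsmul_eq_mul]
    ring
  rw [hsum]
  refine Finset.sum_le_sum fun t _ => ?_
  exact two_point_bound (historyLaw (shiftedState i j 0 h0) π n) _ _ _ _
    (measurable_historyRatio _ _ n) (measurable_historyRatio _ _ n)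
    (historyRatio_nonneg _ _ n) (historyRatio_nonneg _ _ n)
    (historyLaw_eq_withDensity _ _ hpos π n) (historyLaw_eq_withDensity _ _ hpos π n)
    (fun h => le_trans (by linarith) (historyRatio_mul_ge hd i j s hs hs' h0 n h))
    _ _ (integrable_gap _ n t _) (integrable_gap _ n t _)
    (fun _ => gap_nonneg _ _) (fun _ => gap_nonneg _ _) (2 * s) (by positivity)
    (fun h => gap_add_gap_shiftedState hij s hs hs' (h t).1)

end DiagonalStates

end QuantumBandit

/-! ### Choice of the shift -/

open QuantumBandit in
theorem mainTheorem3 (d : ℕ) (hd : 2 ≤ d) :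
    ∃ C : ℝ, 0 < C ∧ ∀ (n : ℕ) (π : QuantumBandit.Policy d),
      ∃ ρ : QuantumBandit.states d, C * Real.sqrt n ≤ QuantumBandit.regret n ρ π := by
  have hd' : (0 : ℝ) < d := by positivity
  refine ⟨1 / (8 * d), by positivity, fun n π => ?_⟩
  let i : Fin d := ⟨0, by omega⟩
  let j : Fin d := ⟨1, by omega⟩
  have hij : i ≠ j := by simp [i, j]
  rcases Nat.eq_zero_or_pos n with rfl | hn
  · exact ⟨shiftedState i j 0 (by simp), by simp [regret]⟩
  have hn1 : (1 : ℝ) ≤ n := by exact_mod_cast hn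
  have hq : 1 ≤ Real.sqrt n := Real.one_le_sqrt.2 hn1
  have hqq : Real.sqrt n * Real.sqrt n = n := Real.mul_self_sqrt (by positivity)
  set q := Real.sqrt n
  -- With `s = 1/(2d√n)`, `n(ds)² = 1/4` and `ns/2 = √n/(4d)`; the larger of the two regrets is at
  -- least half of this, whence the constant `1/(8d)`.
  have hs0 : 0 ≤ 1 / (2 * d * q) := by positivity
  have hs : |1 / (2 * d * q)| ≤ 1 / (d : ℝ) := by
    rw [abs_of_nonneg hs0]
    gcongr
    nlinarith
  have h := regret_add_regret_ge hd hij (1 / (2 * d * q)) hs0 hs (by rwa [abs_neg]) n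
    (by rw [← hqq]; field_simp; norm_num) π
  have he : (n : ℝ) * (1 / (2 * d * q) / 2) = 2 * (1 / (8 * d) * q) := by
    rw [← hqq]
    field_simp
    norm_num
  rw [he] at h
  by_contra! hcon
  linarith [hcon (shiftedState i j (1 / (2 * d * q)) hs),
    hcon (shiftedState i j (-(1 / (2 * d * q))) (by rwa [abs_neg]))]
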